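/- Let $E$ be a (real) Banach lattice and $E^*$ its norm dual, with the dual norm and the order $f\le g\iff f(x)\le g(x)$ for all $x\in E_+$, under which $E^*$ is a Banach lattice. A net $(f_\alpha)$ in $E^*$ is $w^*$-null if $f_\alpha(x)\to 0$ for every $x\in E$, and it is $uaw$-null (unbounded absolutely weakly null) if for every $g\in E^*_+$ the net $(|f_\alpha|\wedge g)$ converges to $0$ in the weak topology $\sigma(E^*,E^{**})$. A Banach lattice $F$ is order continuous if $\|x_\alpha\|\to 0$ for every net $x_\alpha\downarrow 0$ in $F$. It is atomic if for every $x>0$ in $F$ there is an atom $a\le x$, where an atom is an element $a>0$ such that every $y$ with $0\le y\le a$ is a scalar multiple of $a$. Then the following are equivalent: (i) every $w^*$-null net in $E^*$ is $uaw$-null; (ii) $E^*$ is atomic and both $E$ and $E^*$ are order continuous. -/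

import Mathlib

open Filter Topology

universe u

set_option linter.unusedSectionVars false

namespace BanachLattice

section Dual

variable {E : Type u} [NormedAddCommGroup E] [NormedSpace ℝ E] [Lattice E]
  [IsOrderedAddMonoid E] [HasSolidNorm E]

/-- On the positive cone, the value at `x` of the positive part of the functional `f`,
`sup {f y : 0 ≤ y ≤ x}`. -/
noncomputable def posPartCone (f : StrongDual ℝ E) (x : E) : ℝ := sSup (f '' Set.Icc 0 x)

theorem norm_le_of_mem_Icc {x y : E} (hy : y ∈ Set.Icc 0 x) : ‖y‖ ≤ ‖x‖ := by
  apply HasSolidNorm.solid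
  rw [abs_of_nonneg hy.1, abs_of_nonneg (hy.1.trans hy.2)]
  exact hy.2

theorem apply_le_of_mem_Icc (f : StrongDual ℝ E) {x y : E} (hy : y ∈ Set.Icc 0 x) :
    f y ≤ ‖f‖ * ‖x‖ :=
  ((le_abs_self _).trans (f.le_opNorm y)).trans
    (mul_le_mul_of_nonneg_left (norm_le_of_mem_Icc hy) (norm_nonneg _))

theorem bddAbove_image (f : StrongDual ℝ E) (x : E) : BddAbove (f '' Set.Icc 0 x) := by
  refine ⟨‖f‖ * ‖x‖, ?_⟩
  rintro _ ⟨y, hy, rfl⟩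
  exact apply_le_of_mem_Icc f hy

theorem le_posPartCone (f : StrongDual ℝ E) {x y : E} (hy : y ∈ Set.Icc 0 x) :
    f y ≤ posPartCone f x :=
  le_csSup (bddAbove_image f x) ⟨y, hy, rfl⟩

theorem posPartCone_le (f : StrongDual ℝ E) {x : E} (hx : 0 ≤ x) {c : ℝ}
    (h : ∀ y ∈ Set.Icc 0 x, f y ≤ c) : posPartCone f x ≤ c := by
  refine csSup_le ⟨f 0, 0, ⟨le_rfl, hx⟩, rfl⟩ ?_
  rintro _ ⟨y, hy, rfl⟩
  exact h y hy

theorem posPartCone_nonneg (f : StrongDual ℝ E) {x : E} (hx : 0 ≤ x) : 0 ≤ posPartCone f x := by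
  have h := le_posPartCone f (x := x) (y := 0) ⟨le_rfl, hx⟩
  simpa using h

theorem posPartCone_add (f : StrongDual ℝ E) {x y : E} (hx : 0 ≤ x) (hy : 0 ≤ y) :
    posPartCone f (x + y) = posPartCone f x + posPartCone f y := by
  apply le_antisymm
  · refine posPartCone_le f (add_nonneg hx hy) fun z hz => ?_
    have h1 : f (z ⊓ x) ≤ posPartCone f x := le_posPartCone f ⟨le_inf hz.1 hx, inf_le_right⟩
    have h2 : f (z - z ⊓ x) ≤ posPartCone f y := by
      refine le_posPartCone f ⟨sub_nonneg.2 inf_le_left, ?_⟩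
      rw [sub_le_iff_le_add, add_inf]
      refine le_inf ?_ ?_
      · exact le_add_of_nonneg_left hy
      · rw [add_comm]
        exact hz.2
    rw [map_sub] at h2
    linarith
  · rw [← le_sub_iff_add_le]
    refine posPartCone_le f hx fun a ha => ?_
    rw [le_sub_comm]
    refine posPartCone_le f hy fun b hb => ?_
    have h := le_posPartCone f (x := x + y) (y := a + b)
      ⟨add_nonneg ha.1 hb.1, add_le_add ha.2 hb.2⟩
    rw [map_add] at h
    linarith

theorem posPartCone_sub_eq (f : StrongDual ℝ E) {a b c d : E} (ha : 0 ≤ a) (hb : 0 ≤ b)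
    (hc : 0 ≤ c) (hd : 0 ≤ d) (h : a - b = c - d) :
    posPartCone f a - posPartCone f b = posPartCone f c - posPartCone f d := by
  have h' : a + d = c + b := by
    rw [sub_eq_sub_iff_add_eq_add] at h
    exact h
  have h2 := posPartCone_add f ha hd
  rw [h', posPartCone_add f hc hb] at h2
  linarith

/-- The positive part of a functional as an additive map on the whole space. -/
noncomputable def posPartHom (f : StrongDual ℝ E) : E →+ ℝ :=
  AddMonoidHom.mk' (fun x => posPartCone f x⁺ - posPartCone f x⁻) fun x y => by
    have h := posPartCone_sub_eq f (posPart_nonneg (x + y)) (negPart_nonneg (x + y))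
      (add_nonneg (posPart_nonneg x) (posPart_nonneg y))
      (add_nonneg (negPart_nonneg x) (negPart_nonneg y))
      (by rw [add_sub_add_comm]; simp only [posPart_sub_negPart])
    rw [h, posPartCone_add f (posPart_nonneg x) (posPart_nonneg y),
      posPartCone_add f (negPart_nonneg x) (negPart_nonneg y)]
    ring

theorem posPartHom_apply (f : StrongDual ℝ E) (x : E) :
    posPartHom f x = posPartCone f x⁺ - posPartCone f x⁻ := rfl

theorem posPartHom_of_nonneg (f : StrongDual ℝ E) {x : E} (hx : 0 ≤ x) :
    posPartHom f x = posPartCone f x := by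
  have h0 : posPartCone f 0 = 0 := by
    have h := posPartCone_add f (le_refl (0 : E)) (le_refl (0 : E))
    rw [add_zero] at h
    linarith
  rw [posPartHom_apply, posPart_of_nonneg hx, negPart_of_nonneg hx, h0, sub_zero]

theorem posPartHom_bound (f : StrongDual ℝ E) (x : E) : ‖posPartHom f x‖ ≤ ‖f‖ * ‖x‖ := by
  have key : ∀ z : E, 0 ≤ z → z ≤ |x| → posPartCone f z ≤ ‖f‖ * ‖x‖ := fun z h0 hz => by
    refine posPartCone_le f h0 fun y hy => ?_
    have h := apply_le_of_mem_Icc f (x := |x|) ⟨hy.1, hy.2.trans hz⟩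
    rwa [norm_abs_eq_norm] at h
  have h1 := key x⁺ (posPart_nonneg x) (sup_le (le_abs_self x) (abs_nonneg x))
  have h2 := key x⁻ (negPart_nonneg x) (sup_le (neg_le_abs x) (abs_nonneg x))
  have h3 := posPartCone_nonneg f (posPart_nonneg x)
  have h4 := posPartCone_nonneg f (negPart_nonneg x)
  rw [posPartHom_apply, Real.norm_eq_abs, abs_le]
  constructor <;> linarith

/-- The positive part of a functional as a continuous linear functional. -/
noncomputable def posPartDual (f : StrongDual ℝ E) : StrongDual ℝ E :=
  (posPartHom f).toRealLinearMap
    (AddMonoidHomClass.continuous_of_bound (posPartHom f) ‖f‖ (posPartHom_bound f))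

theorem posPartDual_of_nonneg (f : StrongDual ℝ E) {x : E} (hx : 0 ≤ x) :
    posPartDual f x = posPartCone f x :=
  posPartHom_of_nonneg f hx

/-- The order of the dual: `f ≤ g` iff `f x ≤ g x` for every `x ≥ 0`. -/
instance dualPartialOrder : PartialOrder (StrongDual ℝ E) where
  le f g := ∀ x : E, 0 ≤ x → f x ≤ g x
  le_refl _ _ _ := le_rfl
  le_trans _ _ _ h1 h2 x hx := (h1 x hx).trans (h2 x hx)
  le_antisymm f g h1 h2 := by
    ext x
    have hp := le_antisymm (h1 _ (posPart_nonneg x)) (h2 _ (posPart_nonneg x))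
    have hn := le_antisymm (h1 _ (negPart_nonneg x)) (h2 _ (negPart_nonneg x))
    rw [← posPart_sub_negPart x, map_sub, map_sub, hp, hn]

theorem dual_le_iff {f g : StrongDual ℝ E} : f ≤ g ↔ ∀ x : E, 0 ≤ x → f x ≤ g x := Iff.rfl

instance dualIsOrderedAddMonoid : IsOrderedAddMonoid (StrongDual ℝ E) where
  add_le_add_left f g h k x hx := by
    simpa using h x hx

theorem isLUB_posPartDual (f : StrongDual ℝ E) : IsLUB {f, 0} (posPartDual f) := by
  constructor
  · rintro g (rfl | rfl) x hx
    · rw [posPartDual_of_nonneg _ hx]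
      exact le_posPartCone _ ⟨hx, le_rfl⟩
    · rw [posPartDual_of_nonneg _ hx]
      exact posPartCone_nonneg f hx
  · intro g hg x hx
    have hf : f ≤ g := hg (by simp)
    have h0 : 0 ≤ g := hg (by simp)
    rw [posPartDual_of_nonneg _ hx]
    refine posPartCone_le f hx fun y hy => (hf y hy.1).trans ?_
    have h : 0 ≤ g (x - y) := h0 (x - y) (sub_nonneg.2 hy.2)
    rw [map_sub] at h
    exact sub_nonneg.1 h

/-- The lattice structure of the dual, with `f ⊔ g = (f - g)⁺ + g`
and `f ⊓ g = f - (f - g)⁺`. -/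
noncomputable instance dualLattice : Lattice (StrongDual ℝ E) :=
  { dualPartialOrder with
    sup := fun f g => posPartDual (f - g) + g
    inf := fun f g => f - posPartDual (f - g)
    le_sup_left := fun f g =>
      sub_le_iff_le_add.1 ((isLUB_posPartDual (f - g)).1 (by simp))
    le_sup_right := fun f g =>
      le_add_of_nonneg_left ((isLUB_posPartDual (f - g)).1 (by simp))
    sup_le := fun f g k hf hg => by
      refine le_sub_iff_add_le.1 ((isLUB_posPartDual (f - g)).2 ?_)
      rintro m (rfl | rfl)
      · exact sub_le_sub_right hf g
      · exact sub_nonneg.2 hg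
    inf_le_left := fun f g =>
      sub_le_self f ((isLUB_posPartDual (f - g)).1 (by simp))
    inf_le_right := fun f g =>
      sub_le_comm.1 ((isLUB_posPartDual (f - g)).1 (by simp))
    le_inf := fun k f g hf hg => by
      refine le_sub_comm.1 ((isLUB_posPartDual (f - g)).2 ?_)
      rintro m (rfl | rfl)
      · exact sub_le_sub_left hg f
      · exact sub_nonneg.2 hf }

end Dual

section Notions

variable (F : Type u) [NormedAddCommGroup F] [NormedSpace ℝ F] [Lattice F]

variable {F} in
/-- `a` is an atom: `a > 0` and every `x` with `0 ≤ x ≤ a` is a scalar multiple of `a`. -/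
def IsLatticeAtom (a : F) : Prop :=
  0 < a ∧ ∀ x : F, 0 ≤ x → x ≤ a → ∃ c : ℝ, x = c • a

/-- `F` is atomic: every positive nonzero vector dominates an atom. -/
def IsAtomicLattice : Prop :=
  ∀ x : F, 0 < x → ∃ a : F, IsLatticeAtom a ∧ a ≤ x

/-- `F` is order continuous: every net decreasing to `0` converges to `0` in norm. Index sets in
the universe of `F` suffice, since a decreasing net can be replaced by its range. -/
def IsOrderContinuous : Prop :=
  ∀ (ι : Type u) [Preorder ι] [IsDirectedOrder ι] [Nonempty ι] (x : ι → F),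
    Antitone x → IsGLB (Set.range x) 0 → Tendsto (fun i => ‖x i‖) atTop (𝓝 0)

variable {F} in
/-- The net `x` is `uaw`-convergent to `y`: `|x i - y| ⊓ v → 0` weakly for every `v ≥ 0`. -/
def UawTendsto {ι : Type u} [Preorder ι] (x : ι → F) (y : F) : Prop :=
  ∀ v : F, 0 ≤ v → Tendsto (fun i => toWeakSpace ℝ F (|x i - y| ⊓ v)) atTop (𝓝 0)

end Notions

end BanachLattice

/-! The link between E and E* is a coordinate vector of an atom a of E*: some x ≥ 0 in E with a(x) =
1 and a(z)x ≤ z for all z ≥ 0. The interval [0, x] is then a segment, so |f|(x) = |f(x)| for every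
functional f. Suppose E* is atomic and order continuous and its atoms have coordinate vectors.
Removing finitely many coordinates from k in [0, g] leaves a positive remainder below that of g, and
the remainders of g decrease to 0. So [0, g] is approximated in norm, uniformly, by finitely many
coordinates (`exists_finset_norm_sub_sum_le`).

(ii) ⇒ (i): order continuity of E provides the vector of a as the least element of {y ≥ 0 : a(y) =
1}. Apply the approximation to |f_α| ∧ g: its coordinates are at most |f_α(x_a)| → 0, so it tends to
0 even in norm.

(i) ⇒ (ii): a net decreasing to 0 in E* is w*-null, hence weakly null by (i), hence norm null by
Hahn–Banach. Moreover (i) makes f ↦ (|f| ∧ g)(x) w*-continuous at 0. If g > 0 dominated no atom, a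
Lyapunov-type extreme point argument would give D with |D| = g in any given w*-neighbourhood of 0, a
contradiction. For an atom a, the same continuity keeps a out of the w*-closure of its disjoint
complement, and separation yields a coordinate vector in E. Uniform approximation then makes E order
continuous. -/

namespace BanachLattice

/-! ### Disjointness in vector lattices. -/

section VectorLattice

variable {F : Type u} [AddCommGroup F] [Module ℝ F] [Lattice F] [IsOrderedAddMonoid F]
  [IsOrderedModule ℝ F]

theorem abs_real_smul_le (c : ℝ) (x : F) : |c • x| ≤ |c| • |x| := by
  have key : ∀ (d : ℝ) (y : F), d • y ≤ |d| • |y| := fun d y => by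
    rcases le_total 0 d with hd | hd
    · rw [abs_of_nonneg hd]
      exact smul_le_smul_of_nonneg_left (le_abs_self y) hd
    · rw [abs_of_nonpos hd, ← neg_smul_neg]
      exact smul_le_smul_of_nonneg_left (neg_le_abs y) (neg_nonneg.2 hd)
  refine sup_le (key c x) ?_
  have h := key (-c) x
  rwa [neg_smul, abs_neg] at h

theorem add_inf_le_inf_add_inf {x y z : F} (hx : 0 ≤ x) (hy : 0 ≤ y) (hz : 0 ≤ z) :
    (x + y) ⊓ z ≤ x ⊓ z + y ⊓ z := by
  have h1 : (x + y) ⊓ z - x ⊓ z ≤ y ⊓ z := by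
    rw [sub_le_iff_le_add', inf_add, add_inf, add_inf]
    refine le_inf (le_inf inf_le_left ?_) (le_inf ?_ ?_)
    · exact inf_le_right.trans (le_add_of_nonneg_left hx)
    · exact inf_le_right.trans (le_add_of_nonneg_right hy)
    · exact inf_le_right.trans (le_add_of_nonneg_right hz)
  exact sub_le_iff_le_add'.1 h1

theorem smul_inf_smul_le {c : ℝ} (hc : 0 < c) (x y : F) : (c • x) ⊓ (c • y) ≤ c • (x ⊓ y) := by
  have h : c⁻¹ • ((c • x) ⊓ (c • y)) ≤ x ⊓ y := by
    refine le_inf ?_ ?_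
    · rw [inv_smul_le_iff_of_pos hc]
      exact inf_le_left
    · rw [inv_smul_le_iff_of_pos hc]
      exact inf_le_right
  rwa [inv_smul_le_iff_of_pos hc] at h

theorem smul_inf_eq_zero {c : ℝ} (hc : 0 ≤ c) {x y : F} (hx : 0 ≤ x) (hy : 0 ≤ y)
    (h : x ⊓ y = 0) : (c • x) ⊓ y = 0 := by
  refine le_antisymm ?_ (le_inf (smul_nonneg hc hx) hy)
  have h1 : (c • x) ⊓ y ≤ ((c + 1) • x) ⊓ ((c + 1) • y) := by
    refine inf_le_inf (smul_le_smul_of_nonneg_right (by linarith) hx) ?_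
    have := smul_le_smul_of_nonneg_right (show (1 : ℝ) ≤ c + 1 by linarith) hy
    rwa [one_smul] at this
  refine h1.trans ((smul_inf_smul_le (by linarith) x y).trans ?_)
  rw [h, smul_zero]

theorem posPart_smul_of_nonneg {c : ℝ} (hc : 0 ≤ c) (x : F) : (c • x)⁺ = c • x⁺ := by
  rcases hc.eq_or_lt with rfl | hc
  · simp
  refine le_antisymm (sup_le ?_ (smul_nonneg hc.le (posPart_nonneg x))) ?_
  · exact smul_le_smul_of_nonneg_left (le_posPart x) hc.le
  · rw [← le_inv_smul_iff_of_pos hc]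
    refine sup_le ?_ (smul_nonneg (inv_nonneg.2 hc.le) (posPart_nonneg _))
    rw [le_inv_smul_iff_of_pos hc]
    exact le_posPart _

/-- The disjoint complement of a positive element. -/
def disjointCompl (a : F) (ha : 0 ≤ a) : Submodule ℝ F where
  carrier := {x | |x| ⊓ a = 0}
  zero_mem' := by simpa using ha
  add_mem' {x y} hx hy := by
    refine le_antisymm ?_ (le_inf (abs_nonneg _) ha)
    have h : |x| ⊓ a + |y| ⊓ a = 0 := by rw [hx, hy, add_zero]
    rw [← h]
    exact (inf_le_inf_right a (abs_add_le x y)).trans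
      (add_inf_le_inf_add_inf (abs_nonneg x) (abs_nonneg y) ha)
  smul_mem' c x hx := by
    refine le_antisymm ?_ (le_inf (abs_nonneg _) ha)
    rw [← smul_inf_eq_zero (abs_nonneg c) (abs_nonneg x) ha hx]
    exact inf_le_inf_right a (abs_real_smul_le c x)

theorem mem_disjointCompl {a : F} (ha : 0 ≤ a) {x : F} :
    x ∈ disjointCompl a ha ↔ |x| ⊓ a = 0 := Iff.rfl

/-- Since a ≤ |x| + |a - x|, the element a - |a - x| lies below both |x| and a. This is what later
separates an atom from its disjoint complement. -/
theorem le_abs_sub_of_disjoint {a x : F} (h : |x| ⊓ a = 0) : a ≤ |a - x| := by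
  rw [← sub_nonpos, ← h]
  refine le_inf ?_ (sub_le_self a (abs_nonneg _))
  rw [sub_le_iff_le_add]
  have h1 := abs_add_le x (a - x)
  rw [add_sub_cancel] at h1
  exact (le_abs_self a).trans h1

end VectorLattice

/-! ### Atoms, finite sets of functionals, and Hahn–Banach in normed lattices. -/

section Normed

variable {F : Type u} [NormedAddCommGroup F] [NormedSpace ℝ F] [Lattice F]
  [IsOrderedAddMonoid F] [IsOrderedModule ℝ F] [HasSolidNorm F]

theorem norm_le_norm_of_nonneg {x y : F} (hx : 0 ≤ x) (h : x ≤ y) : ‖x‖ ≤ ‖y‖ := by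
  apply HasSolidNorm.solid
  rwa [abs_of_nonneg hx, abs_of_nonneg (hx.trans h)]

theorem nonpos_of_forall_smul_le {x y : F} (h : ∀ n : ℕ, (n : ℝ) • x ≤ y) : x ≤ 0 := by
  have h1 : Tendsto (fun n : ℕ => (1 / ((n : ℝ) + 1)) • y) atTop (𝓝 ((0 : ℝ) • y)) :=
    tendsto_one_div_add_atTop_nhds_zero_nat.smul_const y
  rw [zero_smul] at h1
  refine ge_of_tendsto' h1 fun n => ?_
  have hp : (0 : ℝ) < (n : ℝ) + 1 := by positivity
  rw [one_div, le_inv_smul_iff_of_pos hp]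
  have := h (n + 1)
  push_cast at this
  exact this

/-- The largest multiple of `a` below `f`. -/
theorem exists_max_smul_le {a f : F} (ha : 0 < a) (hf : 0 ≤ f) :
    ∃ t : ℝ, 0 ≤ t ∧ t • a ≤ f ∧ ∀ s : ℝ, s • a ≤ f → s ≤ t := by
  set T : Set ℝ := {t | t • a ≤ f} with hT
  have h0 : (0 : ℝ) ∈ T := by simpa [hT] using hf
  have hcl : IsClosed T := isClosed_le (by fun_prop) continuous_const
  have hb : BddAbove T := by
    by_contra hb
    rw [not_bddAbove_iff] at hb
    refine ha.not_ge (nonpos_of_forall_smul_le (y := f) fun n => ?_)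
    obtain ⟨t, ht, hnt⟩ := hb n
    exact (smul_le_smul_of_nonneg_right hnt.le ha.le).trans ht
  exact ⟨sSup T, le_csSup hb h0, hcl.csSup_mem ⟨0, h0⟩ hb, fun s hs => le_csSup hb hs⟩

/-- Remove the largest multiple of a below f: the meet of the rest with a is a multiple of a, and a
positive one would contradict maximality. -/
theorem IsLatticeAtom.exists_decomposition {a f : F} (ha : IsLatticeAtom a) (hf : 0 ≤ f) :
    ∃ t : ℝ, 0 ≤ t ∧ t • a ≤ f ∧ f - t • a ∈ disjointCompl a ha.1.le := by
  obtain ⟨t, ht0, ht, hmax⟩ := exists_max_smul_le ha.1 hf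
  have hm : 0 ≤ f - t • a := sub_nonneg.2 ht
  refine ⟨t, ht0, ht, ?_⟩
  rw [mem_disjointCompl, abs_of_nonneg hm]
  have h0 : 0 ≤ (f - t • a) ⊓ a := le_inf hm ha.1.le
  obtain ⟨c, hc⟩ := ha.2 _ h0 inf_le_right
  have hc' : t + c ≤ t := by
    refine hmax _ ?_
    rw [add_smul, ← hc, ← le_sub_iff_add_le']
    exact inf_le_left
  refine le_antisymm ?_ h0
  rw [hc]
  exact smul_nonpos_of_nonpos_of_nonneg (by linarith) ha.1.le

theorem isLatticeAtom_smul {a : F} (ha : IsLatticeAtom a) {c : ℝ} (hc : 0 < c) :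
    IsLatticeAtom (c • a) := by
  refine ⟨lt_of_le_of_ne (smul_nonneg hc.le ha.1.le) (smul_ne_zero hc.ne' ha.1.ne').symm, fun x hx hxa => ?_⟩
  obtain ⟨d, hd⟩ := ha.2 (c⁻¹ • x) (smul_nonneg (inv_nonneg.2 hc.le) hx)
    ((inv_smul_le_iff_of_pos hc).2 hxa)
  refine ⟨d, ?_⟩
  rw [smul_comm, ← hd, smul_inv_smul₀ hc.ne']

/-- An element that is not an atom dominates two disjoint nonzero positive elements. -/
theorem exists_disjoint_of_not_isLatticeAtom {h : F} (hpos : 0 < h) (hna : ¬ IsLatticeAtom h) :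
    ∃ x y : F, 0 < x ∧ x ≤ h ∧ 0 < y ∧ y ≤ h ∧ x ⊓ y = 0 := by
  have : ∃ f : F, 0 ≤ f ∧ f ≤ h ∧ ∀ c : ℝ, f ≠ c • h := by
    by_contra hcon
    push Not at hcon
    exact hna ⟨hpos, hcon⟩
  obtain ⟨f, hf0, hfh, hf⟩ := this
  obtain ⟨t, ht0, ht, hmax⟩ := exists_max_smul_le hpos hf0
  have ht1 : t < 1 := by
    by_contra! h1
    have h2 : h ≤ t • h := by
      have := smul_le_smul_of_nonneg_right h1 hpos.le
      rwa [one_smul] at this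
    exact hf 1 (by rw [one_smul]; exact le_antisymm hfh (h2.trans ht))
  -- For such s, f and s • h are incomparable, so both parts of f - s • h are nonzero; they are
  -- disjoint and below h.
  have : ∃ s : ℝ, t < s ∧ s < 1 ∧ ¬ f ≤ s • h := by
    by_contra hcon
    push Not at hcon
    refine hf t (le_antisymm ?_ ht)
    have hc : Tendsto (fun s : ℝ => s • h) (𝓝[>] t) (𝓝 (t • h)) :=
      ((continuous_id.smul continuous_const).tendsto t).mono_left nhdsWithin_le_nhds
    refine ge_of_tendsto hc ?_
    filter_upwards [Ioo_mem_nhdsGT ht1] with s hs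
    exact hcon s hs.1 hs.2
  obtain ⟨s, hts, hs1, hs⟩ := this
  refine ⟨(f - s • h)⁺, (f - s • h)⁻, ?_, ?_, ?_, ?_, posPart_inf_negPart_eq_zero _⟩
  · refine lt_of_le_of_ne (posPart_nonneg _) fun h0 => hs ?_
    have := posPart_eq_zero.1 h0.symm
    exact sub_nonpos.1 this
  · refine sup_le ?_ hpos.le
    exact (sub_le_self f (smul_nonneg (ht0.trans hts.le) hpos.le)).trans hfh
  · refine lt_of_le_of_ne (negPart_nonneg _) fun h0 => ?_
    have := negPart_eq_zero.1 h0.symm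
    exact absurd (hmax s (sub_nonneg.1 this)) (not_le.2 hts)
  · refine sup_le ?_ hpos.le
    rw [neg_sub]
    refine (sub_le_self _ hf0).trans ?_
    have := smul_le_smul_of_nonneg_right hs1.le hpos.le
    rwa [one_smul] at this

/-- An atomless interval is infinite-dimensional. In the induction, h splits into disjoint pieces,
each carrying a solution for the earlier functionals; a combination of the two kills one more and is
nonzero by disjointness. -/
theorem exists_ne_zero_abs_le_forall_eq_zero {X : Type*} [DecidableEq X] (L : X → F →ₗ[ℝ] ℝ)
    (s : Finset X) (h : F) (hpos : 0 < h) (hna : ∀ b, IsLatticeAtom b → ¬ b ≤ h) :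
    ∃ k : F, k ≠ 0 ∧ |k| ≤ h ∧ ∀ y ∈ s, L y k = 0 := by
  induction s using Finset.induction_on generalizing h with
  | empty => exact ⟨h, hpos.ne', (abs_of_nonneg hpos.le).le, by simp⟩
  | insert y s hy ih =>
    obtain ⟨h1, h2, hp1, hl1, hp2, hl2, hd⟩ :=
      exists_disjoint_of_not_isLatticeAtom hpos fun hat => hna h hat le_rfl
    obtain ⟨k1, hk1, hkl1, hks1⟩ := ih h1 hp1 fun b hb hbh => hna b hb (hbh.trans hl1)
    obtain ⟨k2, hk2, hkl2, hks2⟩ := ih h2 hp2 fun b hb hbh => hna b hb (hbh.trans hl2)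
    by_cases hz : L y k1 = 0
    · refine ⟨k1, hk1, hkl1.trans hl1, fun z hz' => ?_⟩
      rcases Finset.mem_insert.1 hz' with rfl | hz'
      exacts [hz, hks1 z hz']
    set p := L y k1 with hp
    set q := L y k2 with hq
    -- Dividing by this brings the combination q • k1 - p • k2 back below h.
    set C : ℝ := |q| + |p| with hC
    have hCpos : 0 < C := add_pos_of_nonneg_of_pos (abs_nonneg _) (abs_pos.2 hz)
    set k := q • k1 - p • k2 with hk
    have hk0 : k ≠ 0 := by
      intro hk0
      have he : p • k2 = q • k1 := (sub_eq_zero.1 hk0).symm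
      have he2 : k2 = (p⁻¹ * q) • k1 := by rw [mul_smul, ← he, inv_smul_smul₀ hz]
      apply hk2
      have h3 : |k2| ≤ (|p⁻¹ * q| • h1) ⊓ h2 := by
        refine le_inf ?_ hkl2
        conv_lhs => rw [he2]
        exact (abs_real_smul_le _ _).trans (smul_le_smul_of_nonneg_left hkl1 (abs_nonneg _))
      rw [smul_inf_eq_zero (abs_nonneg _) hp1.le hp2.le hd] at h3
      exact le_antisymm ((le_abs_self k2).trans h3) (neg_nonpos.1 ((neg_le_abs k2).trans h3))
    refine ⟨C⁻¹ • k, smul_ne_zero (inv_ne_zero hCpos.ne') hk0, ?_, fun z hz' => ?_⟩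
    · refine (abs_real_smul_le _ _).trans ?_
      rw [abs_of_pos (inv_pos.2 hCpos), inv_smul_le_iff_of_pos hCpos, hk, sub_eq_add_neg, hC,
        add_smul]
      refine (abs_add_le _ _).trans (add_le_add ?_ ?_)
      · exact (abs_real_smul_le _ _).trans
          (smul_le_smul_of_nonneg_left (hkl1.trans hl1) (abs_nonneg _))
      · rw [abs_neg]
        exact (abs_real_smul_le _ _).trans
          (smul_le_smul_of_nonneg_left (hkl2.trans hl2) (abs_nonneg _))
    · rw [map_smul, hk, map_sub, map_smul, map_smul]
      rcases Finset.mem_insert.1 hz' with rfl | hz'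
      · rw [← hp, ← hq]; simp [mul_comm]
      · rw [hks1 z hz', hks2 z hz']; simp

/-- A positive decreasing net that converges weakly to zero converges in norm to zero. -/
theorem tendsto_norm_of_weakly_null {ι : Type*} [Preorder ι] [IsDirectedOrder ι] [Nonempty ι]
    {x : ι → F} (hx : Antitone x) (h0 : ∀ i, 0 ≤ x i)
    (hw : ∀ f : StrongDual ℝ F, Tendsto (fun i => f (x i)) atTop (𝓝 0)) :
    Tendsto (fun i => ‖x i‖) atTop (𝓝 0) := by
  -- Monotonicity makes this upward closure convex, so a functional would separate 0 from its norm
  -- closure, against weak convergence.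
  set C : Set F := {z | ∃ i, x i ≤ z} with hC
  have hconv : Convex ℝ C := by
    rintro y ⟨i, hi⟩ z ⟨j, hj⟩ p q hp hq hpq
    obtain ⟨k, hik, hjk⟩ := exists_ge_ge i j
    refine ⟨k, ?_⟩
    rw [← one_smul ℝ (x k), ← hpq, add_smul]
    exact add_le_add (smul_le_smul_of_nonneg_left ((hx hik).trans hi) hp)
      (smul_le_smul_of_nonneg_left ((hx hjk).trans hj) hq)
  have hmem : (0 : F) ∈ closure C := by
    by_contra hn
    obtain ⟨f, u, hu, hfu⟩ := geometric_hahn_banach_point_closed hconv.closure isClosed_closure hn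
    rw [map_zero] at hu
    refine absurd (ge_of_tendsto' (hw f) fun i => (hfu _ (subset_closure ⟨i, le_rfl⟩)).le) ?_
    exact not_le.2 hu
  rw [Metric.tendsto_nhds]
  intro ε hε
  obtain ⟨z, ⟨i, hi⟩, hz⟩ := Metric.mem_closure_iff.1 hmem ε hε
  filter_upwards [eventually_ge_atTop i] with j hj
  rw [dist_zero_left] at hz
  rw [dist_zero_right, norm_norm]
  exact (norm_le_norm_of_nonneg (h0 j) ((hx hj).trans hi)).trans_lt hz

theorem nonneg_of_forall_dual {x : F}
    (h : ∀ f : StrongDual ℝ F, (∀ y, 0 ≤ y → 0 ≤ f y) → 0 ≤ f x) : 0 ≤ x := by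
  let C : ProperCone ℝ F :=
    { carrier := {y | 0 ≤ y}
      add_mem' := fun ha hb => add_nonneg ha hb
      zero_mem' := le_refl 0
      smul_mem' := fun c y hy => smul_nonneg c.2 hy
      isClosed' := isClosed_le continuous_const continuous_id }
  by_contra hx
  obtain ⟨f, hf, hfx⟩ := C.hyperplane_separation_point (x₀ := x) hx
  exact absurd (h f hf) (not_le.2 hfx)

end Normed

end BanachLattice

namespace BanachLattice

/-! ### The dual as a normed lattice, and its atoms. -/

section DualLattice

variable {E : Type u} [NormedAddCommGroup E] [NormedSpace ℝ E] [Lattice E]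
  [IsOrderedAddMonoid E] [HasSolidNorm E]

instance dualIsOrderedModule : IsOrderedModule ℝ (StrongDual ℝ E) where
  smul_le_smul_of_nonneg_left c hc f g hfg x hx := by
    simpa using mul_le_mul_of_nonneg_left (hfg x hx) hc
  smul_le_smul_of_nonneg_right f hf c d hcd x hx := by
    simpa using mul_le_mul_of_nonneg_right hcd (hf x hx)

theorem dual_apply_mono {f : StrongDual ℝ E} (hf : 0 ≤ f) {x y : E} (h : x ≤ y) : f x ≤ f y := by
  have : 0 ≤ f (y - x) := hf (y - x) (sub_nonneg.2 h)
  rw [map_sub] at this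
  exact sub_nonneg.1 this

theorem abs_dual_apply_le_of_nonneg (f : StrongDual ℝ E) {x : E} (hx : 0 ≤ x) : |f x| ≤ |f| x := by
  rw [abs_le']
  exact ⟨le_abs_self f x hx, neg_le_abs f x hx⟩

theorem abs_dual_apply_le (f : StrongDual ℝ E) (x : E) : |f x| ≤ |f| |x| := by
  have h1 := abs_le.1 (abs_dual_apply_le_of_nonneg f (posPart_nonneg x))
  have h2 := abs_le.1 (abs_dual_apply_le_of_nonneg f (negPart_nonneg x))
  have h3 : |f| |x| = |f| x⁺ + |f| x⁻ := by rw [← map_add, posPart_add_negPart]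
  have h4 : f x = f x⁺ - f x⁻ := by rw [← map_sub, posPart_sub_negPart]
  rw [h3, h4, abs_le]
  constructor <;> linarith

/-- Half of the Riesz–Kantorovich formula, from |f| = (2f)⁺ - f: as y runs over [0, x], 2y - x runs
over [-x, x]. -/
theorem abs_dual_apply_le_of_forall (f : StrongDual ℝ E) {x : E} (hx : 0 ≤ x) {c : ℝ}
    (h : ∀ y ∈ Set.Icc 0 x, f (y + y - x) ≤ c) : |f| x ≤ c := by
  have he : |f| = posPartDual (f + f) - f := by
    change posPartDual (f - -f) + -f = _
    rw [sub_neg_eq_add, sub_eq_add_neg]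
  rw [he, sub_apply, posPartDual_of_nonneg _ hx, sub_le_iff_le_add]
  refine posPartCone_le _ hx fun y hy => ?_
  have := h y hy
  rw [map_sub, map_add] at this
  rw [add_apply]
  linarith

instance dualHasSolidNorm : HasSolidNorm (StrongDual ℝ E) where
  solid f g h := by
    refine f.opNorm_le_bound (norm_nonneg g) fun x => ?_
    rw [Real.norm_eq_abs]
    refine (abs_dual_apply_le f x).trans ((h _ (abs_nonneg x)).trans ?_)
    refine abs_dual_apply_le_of_forall g (abs_nonneg x) fun y hy => ?_
    have hn : ‖y + y - |x|‖ ≤ ‖x‖ := by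
      apply HasSolidNorm.solid
      rw [abs_le']
      constructor
      · rw [sub_le_iff_le_add]; exact add_le_add hy.2 hy.2
      · rw [neg_sub]; exact sub_le_self _ (add_nonneg hy.1 hy.1)
    exact (le_abs_self _).trans ((g.le_opNorm _).trans
      (mul_le_mul_of_nonneg_left hn (norm_nonneg _)))

theorem isClosed_toWeakDual_preimage_Icc (f g : StrongDual ℝ E) :
    IsClosed {h : WeakDual ℝ E | f ≤ h.toStrongDual ∧ h.toStrongDual ≤ g} := by
  have : {h : WeakDual ℝ E | f ≤ h.toStrongDual ∧ h.toStrongDual ≤ g} =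
      ⋂ (x : E) (_ : 0 ≤ x), {h : WeakDual ℝ E | f x ≤ h x} ∩ {h : WeakDual ℝ E | h x ≤ g x} := by
    ext h
    simp only [Set.mem_ofPred_eq, Set.mem_iInter, Set.mem_inter_iff]
    exact ⟨fun hh x hx => ⟨hh.1 x hx, hh.2 x hx⟩,
      fun hh => ⟨fun x hx => (hh x hx).1, fun x hx => (hh x hx).2⟩⟩
  rw [this]
  refine isClosed_iInter fun x => isClosed_iInter fun _ => IsClosed.inter ?_ ?_
  · exact isClosed_le continuous_const (WeakDual.eval_continuous x)
  · exact isClosed_le (WeakDual.eval_continuous x) continuous_const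

/-- A net decreasing to zero in the dual converges to zero pointwise. -/
theorem tendsto_apply_of_antitone_dual {ι : Type*} [Preorder ι] [IsDirectedOrder ι] [Nonempty ι]
    {f : ι → StrongDual ℝ E} (hf : Antitone f) (hglb : IsGLB (Set.range f) 0) (x : E) :
    Tendsto (fun i => f i x) atTop (𝓝 0) := by
  have h0 : ∀ i, 0 ≤ f i := fun i => hglb.1 ⟨i, rfl⟩
  have hpos : ∀ z : E, 0 ≤ z → Tendsto (fun i => f i z) atTop (𝓝 (⨅ i, f i z)) := fun z hz =>
    tendsto_atTop_ciInf (fun i j hij => hf hij z hz) ⟨0, by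
      rintro _ ⟨i, rfl⟩
      exact h0 i z hz⟩
  have hlim : ∀ z : E, ∃ l : ℝ, Tendsto (fun i => f i z) atTop (𝓝 l) := fun z => by
    refine ⟨_, ((hpos _ (posPart_nonneg z)).sub (hpos _ (negPart_nonneg z))).congr fun i => ?_⟩
    rw [← map_sub, posPart_sub_negPart]
  choose l hl using hlim
  obtain ⟨i₀⟩ := ‹Nonempty ι›
  let L : E →ₗ[ℝ] ℝ :=
    { toFun := l
      map_add' := fun y z => tendsto_nhds_unique (hl (y + z))
        (((hl y).add (hl z)).congr fun i => (map_add (f i) y z).symm)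
      map_smul' := fun c y => tendsto_nhds_unique (hl (c • y))
        (((hl y).const_mul c).congr fun i => by simp) }
  let g : StrongDual ℝ E := L.mkContinuous ‖f i₀‖ fun z => by
    refine le_of_tendsto (hl z).norm ?_
    filter_upwards [eventually_ge_atTop i₀] with i hi
    refine ((f i).le_opNorm z).trans (mul_le_mul_of_nonneg_right ?_ (norm_nonneg z))
    exact norm_le_norm_of_nonneg (h0 i) (hf hi)
  have hg : g ≤ 0 := by
    refine hglb.2 ?_
    rintro _ ⟨i, rfl⟩ z hz
    refine le_of_tendsto (hl z) ?_
    filter_upwards [eventually_ge_atTop i] with j hj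
    exact hf hj z hz
  have hg0 : 0 ≤ g := fun z hz => ge_of_tendsto' (hl z) fun i => h0 i z hz
  have hx : l x = 0 := by
    have : g x = 0 := by rw [le_antisymm hg hg0]; rfl
    exact this
  rw [← hx]
  exact hl x

/-- `x` is a positive vector representing the coordinate of the positive functional `a`:
`a x = 1` and `a z • x ≤ z` for every `z ≥ 0`. -/
def IsCoordinate (a : StrongDual ℝ E) (x : E) : Prop :=
  0 ≤ x ∧ a x = 1 ∧ ∀ z, 0 ≤ z → a z • x ≤ z

section Ordered

variable [IsOrderedModule ℝ E]

/-- The coordinate inequality for y and for x - y gives the two bounds. -/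
theorem IsCoordinate.eq_smul {a : StrongDual ℝ E} {x : E} (h : IsCoordinate a x) {y : E}
    (hy : y ∈ Set.Icc 0 x) : y = a y • x := by
  refine le_antisymm ?_ (h.2.2 y hy.1)
  have := h.2.2 (x - y) (sub_nonneg.2 hy.2)
  rw [map_sub, h.2.1, sub_smul, one_smul] at this
  exact (sub_le_sub_iff_left x).1 this

theorem IsCoordinate.abs_apply {a : StrongDual ℝ E} {x : E} (ha : 0 ≤ a) (h : IsCoordinate a x)
    (f : StrongDual ℝ E) : |f| x = |f x| := by
  refine le_antisymm ?_ (abs_dual_apply_le_of_nonneg f h.1)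
  refine abs_dual_apply_le_of_forall f h.1 fun y hy => ?_
  have h0 : 0 ≤ a y := ha y hy.1
  have h1 : a y ≤ 1 := h.2.1 ▸ dual_apply_mono ha hy.2
  rw [h.eq_smul hy, map_sub, map_add, map_smul, smul_eq_mul]
  refine le_trans ?_ (show |2 * a y - 1| * |f x| ≤ |f x| from ?_)
  · rw [← abs_mul]
    refine le_trans (le_of_eq ?_) (le_abs_self _)
    ring
  · refine mul_le_of_le_one_left (abs_nonneg _) ?_
    rw [abs_le]
    constructor <;> linarith

/-- An atom of the dual takes the value `0` on one of two disjoint positive vectors. -/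
theorem IsLatticeAtom.apply_eq_zero_or {a : StrongDual ℝ E} (ha : IsLatticeAtom a) {x y : E}
    (hx : 0 ≤ x) (hy : 0 ≤ y) (hxy : x ⊓ y = 0) : a x = 0 ∨ a y = 0 := by
  by_cases hne : x - y = 0
  · left
    rw [← sub_eq_zero.1 hne, inf_idem] at hxy
    rw [hxy, map_zero]
  have hp : (x - y)⁺ = x := by
    change (x - y) ⊔ 0 = x
    have h := inf_add_sup x y
    rw [hxy, zero_add] at h
    rw [← sub_self y, ← sup_sub, h, add_sub_cancel_right]
  have hn : (x - y)⁻ = y := by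
    have := posPart_sub_negPart (x - y)
    rw [hp] at this
    simpa using this
  have ha0 : 0 ≤ a := ha.1.le
  -- Extend x - y ↦ a x below z ↦ a z⁺. Then 0 ≤ b ≤ a forces b = c • a, while b x ≤ a x, b y ≥ 0
  -- and b x - b y = a x force b x = a x and b y = 0.
  obtain ⟨b, hb, hba⟩ := exists_extension_of_le_sublinear
    (LinearPMap.mkSpanSingleton (x - y) (a x) hne) (fun z => a z⁺)
    (fun c hc z => by rw [posPart_smul_of_nonneg hc.le, map_smul, smul_eq_mul])
    (fun z w => by
      rw [← map_add]
      refine dual_apply_mono ha0 (sup_le (add_le_add (le_posPart z) (le_posPart w)) ?_)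
      exact add_nonneg (posPart_nonneg z) (posPart_nonneg w))
    (by
      rintro ⟨z, hz⟩
      obtain ⟨t, rfl⟩ := Submodule.mem_span_singleton.1 hz
      rw [LinearPMap.mkSpanSingleton'_apply]
      change t • a x ≤ a (t • (x - y))⁺
      rcases le_total 0 t with ht | ht
      · rw [posPart_smul_of_nonneg ht, hp, map_smul]
      · exact (mul_nonpos_of_nonpos_of_nonneg ht (ha0 x hx)).trans (ha0 _ (posPart_nonneg _)))
  have hbn : ∀ z : E, 0 ≤ z → 0 ≤ b z := fun z hz => by
    have := hba (-z)
    rw [posPart_eq_zero.2 (neg_nonpos.2 hz), map_zero, map_neg] at this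
    linarith
  have hbxy : b x - b y = a x := by
    have := hb ⟨x - y, Submodule.mem_span_singleton_self _⟩
    rw [← map_sub, this]
    exact LinearPMap.mkSpanSingleton_apply ℝ ℝ hne (a x)
  have hble : ∀ z, b z ≤ ‖a‖ * ‖z‖ := fun z => by
    refine (hba z).trans ((le_abs_self _).trans ((a.le_opNorm _).trans ?_))
    refine mul_le_mul_of_nonneg_left ?_ (norm_nonneg a)
    rw [← norm_abs_eq_norm z]
    exact norm_le_norm_of_nonneg (posPart_nonneg z) (sup_le (le_abs_self z) (abs_nonneg z))
  let b' : StrongDual ℝ E := b.mkContinuous ‖a‖ fun z => by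
    rw [Real.norm_eq_abs, abs_le']
    refine ⟨hble z, ?_⟩
    have := hble (-z)
    rwa [map_neg, norm_neg] at this
  obtain ⟨c, hc⟩ := ha.2 b' hbn fun z hz => by
    have := hba z
    rwa [posPart_of_nonneg hz] at this
  have hcv : ∀ z, b z = c * a z := fun z => DFunLike.congr_fun hc z
  have h1 := hba x
  rw [posPart_of_nonneg hx] at h1
  have h2 := hbn y hy
  have h3 : c * a x = a x := by rw [← hcv]; linarith
  have h4 : c * a y = 0 := by rw [← hcv]; linarith
  rcases mul_eq_zero.1 h4 with h5 | h5
  · left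
    rw [h5, zero_mul] at h3
    exact h3.symm
  · exact Or.inr h5

end Ordered

end DualLattice

end BanachLattice

namespace BanachLattice

/-! ### Coordinate vectors and finite approximation. -/

section Coordinates

variable {E : Type u} [NormedAddCommGroup E] [NormedSpace ℝ E] [Lattice E]
  [IsOrderedAddMonoid E] [IsOrderedModule ℝ E] [HasSolidNorm E]

/-- In an order continuous lattice, a downward directed set bounded below by `0` and its lower
bounds are at distance zero. -/
theorem IsOrderContinuous.exists_norm_sub_lt (hE : IsOrderContinuous E) {D : Set E}
    (hne : D.Nonempty) (hdir : DirectedOn (· ≥ ·) D) (h0 : ∀ d ∈ D, 0 ≤ d) {ε : ℝ} (hε : 0 < ε) :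
    ∃ d ∈ D, ∃ l ∈ lowerBounds D, ‖d - l‖ < ε := by
  have : Nonempty (↥D)ᵒᵈ := ⟨OrderDual.toDual ⟨_, hne.some_mem⟩⟩
  have : Nonempty ↥(lowerBounds D) := ⟨⟨0, h0⟩⟩
  have : IsDirectedOrder (↥D)ᵒᵈ := ⟨fun a b => by
    obtain ⟨c, hc, hca, hcb⟩ := hdir _ (OrderDual.ofDual a).2 _ (OrderDual.ofDual b).2
    exact ⟨OrderDual.toDual ⟨c, hc⟩, hca, hcb⟩⟩
  have : IsDirectedOrder ↥(lowerBounds D) := ⟨fun a b =>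
    ⟨⟨a.1 ⊔ b.1, fun d hd => sup_le (a.2 hd) (b.2 hd)⟩, le_sup_left (a := a.1),
      le_sup_right (a := a.1)⟩⟩
  have : IsDirectedOrder ((↥D)ᵒᵈ × ↥(lowerBounds D)) := ⟨fun p q => by
    obtain ⟨a, ha⟩ := exists_ge_ge p.1 q.1
    obtain ⟨b, hb⟩ := exists_ge_ge p.2 q.2
    exact ⟨(a, b), ⟨ha.1, hb.1⟩, ⟨ha.2, hb.2⟩⟩⟩
  let x : (↥D)ᵒᵈ × ↥(lowerBounds D) → E := fun p => (OrderDual.ofDual p.1).1 - p.2.1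
  have hanti : Antitone x := fun p q hpq => sub_le_sub hpq.1 hpq.2
  have hglb : IsGLB (Set.range x) 0 := by
    constructor
    · rintro _ ⟨p, rfl⟩
      exact sub_nonneg.2 (p.2.2 (OrderDual.ofDual p.1).2)
    · intro z hz
      -- Starting from the lower bound 0, iteration puts every multiple of z below D, so z ≤ 0 by
      -- the Archimedean property.
      have hadd : ∀ l ∈ lowerBounds D, l + z ∈ lowerBounds D := fun l hl d hd =>
        le_sub_iff_add_le'.1 (hz ⟨(OrderDual.toDual ⟨d, hd⟩, ⟨l, hl⟩), rfl⟩)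
      have hn : ∀ n : ℕ, (n : ℝ) • z ∈ lowerBounds D := fun n => by
        induction n with
        | zero =>
          rw [Nat.cast_zero, zero_smul]
          exact h0
        | succ n ih =>
          have := hadd _ ih
          rwa [Nat.cast_succ, add_smul, one_smul]
      exact nonpos_of_forall_smul_le fun n => hn n hne.some_mem
  obtain ⟨p, hp⟩ := ((hE _ x hanti hglb).eventually (gt_mem_nhds hε)).exists
  exact ⟨_, (OrderDual.ofDual p.1).2, _, p.2.2, hp⟩

theorem IsOrderContinuous.exists_isLeast [CompleteSpace E] (hE : IsOrderContinuous E) {D : Set E}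
    (hne : D.Nonempty) (hdir : DirectedOn (· ≥ ·) D) (h0 : ∀ d ∈ D, 0 ≤ d) (hcl : IsClosed D) :
    ∃ z, IsLeast D z := by
  have hpos : ∀ n : ℕ, (0 : ℝ) < 1 / ((n : ℝ) + 1) := fun n => Nat.one_div_pos_of_nat
  choose d hd l hl hdl using fun n : ℕ => hE.exists_norm_sub_lt hne hdir h0 (hpos n)
  -- A common minorant c in D lies above both l m and l n.
  have hdist : ∀ m n, ‖d m - d n‖ ≤ ‖d m - l m‖ + ‖d n - l n‖ := fun m n => by
    obtain ⟨c, hc, hcm, hcn⟩ := hdir _ (hd m) _ (hd n)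
    have h1 : ‖d m - c‖ ≤ ‖d m - l m‖ :=
      norm_le_norm_of_nonneg (sub_nonneg.2 hcm) (sub_le_sub_left (hl m hc) _)
    have h2 : ‖d n - c‖ ≤ ‖d n - l n‖ :=
      norm_le_norm_of_nonneg (sub_nonneg.2 hcn) (sub_le_sub_left (hl n hc) _)
    calc ‖d m - d n‖ = ‖(d m - c) - (d n - c)‖ := by rw [sub_sub_sub_cancel_right]
      _ ≤ _ := (norm_sub_le _ _).trans (add_le_add h1 h2)
  have hlim : Tendsto (fun n : ℕ => 1 / ((n : ℝ) + 1)) atTop (𝓝 0) :=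
    tendsto_one_div_add_atTop_nhds_zero_nat
  have hcauchy : CauchySeq d := by
    refine cauchySeq_of_le_tendsto_0 (fun n : ℕ => 1 / ((n : ℝ) + 1) + 1 / ((n : ℝ) + 1)) ?_ ?_
    · intro m n N hm hn
      rw [dist_eq_norm]
      refine (hdist m n).trans (add_le_add ?_ ?_)
      · exact (hdl m).le.trans (Nat.one_div_le_one_div hm)
      · exact (hdl n).le.trans (Nat.one_div_le_one_div hn)
    · simpa using hlim.add hlim
  obtain ⟨z, hz⟩ := cauchySeq_tendsto_of_complete hcauchy
  refine ⟨z, hcl.mem_of_tendsto hz (Eventually.of_forall hd), fun y hy => ?_⟩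
  have hsub : Tendsto (fun n => d n - l n) atTop (𝓝 0) :=
    squeeze_zero_norm (fun n => (hdl n).le) hlim
  have hlz : Tendsto l atTop (𝓝 z) := by
    simpa using hz.sub hsub
  exact le_of_tendsto' hlz fun n => hl n hy

theorem IsLatticeAtom.apply_inf_eq {a : StrongDual ℝ E} (ha : IsLatticeAtom a) {x y : E}
    (hxy : a x = a y) : a (x ⊓ y) = a x := by
  have h : (x - x ⊓ y) ⊓ (y - x ⊓ y) = 0 := by rw [← inf_sub, sub_self]
  rcases ha.apply_eq_zero_or (sub_nonneg.2 inf_le_left) (sub_nonneg.2 inf_le_right) h with h1 | h1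
  · rw [map_sub] at h1
    linarith
  · rw [map_sub] at h1
    linarith

theorem exists_apply_eq_one {a : StrongDual ℝ E} (ha : 0 < a) : ∃ u : E, 0 ≤ u ∧ a u = 1 := by
  by_contra hcon
  push Not at hcon
  refine ha.not_ge fun z hz => ?_
  by_contra h
  rw [not_le] at h
  have h : 0 < a z := h
  refine hcon ((a z)⁻¹ • z) (smul_nonneg (inv_nonneg.2 h.le) hz) ?_
  rw [map_smul, smul_eq_mul, inv_mul_cancel₀ h.ne']

/-- If `E` is order continuous, every atom of the dual has a coordinate vector in `E`. -/
theorem IsOrderContinuous.exists_isCoordinate [CompleteSpace E] (hE : IsOrderContinuous E)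
    {a : StrongDual ℝ E} (ha : IsLatticeAtom a) : ∃ x, IsCoordinate a x := by
  have ha0 : 0 ≤ a := ha.1.le
  obtain ⟨u, hu0, hu1⟩ := exists_apply_eq_one ha.1
  obtain ⟨z, ⟨hz0, hz1⟩, hzmin⟩ := hE.exists_isLeast (D := {y | 0 ≤ y ∧ a y = 1}) ⟨u, hu0, hu1⟩
    (fun y hy w hw => ⟨y ⊓ w, ⟨le_inf hy.1 hw.1, by
      rw [ha.apply_inf_eq (hy.2.trans hw.2.symm), hy.2]⟩, inf_le_left, inf_le_right⟩)
    (fun y hy => hy.1)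
    ((isClosed_le continuous_const continuous_id).inter
      (isClosed_eq a.continuous continuous_const))
  refine ⟨z, hz0, hz1, fun y hy => ?_⟩
  rcases (ha0 y hy : 0 ≤ a y).eq_or_lt with h | h
  · have h' : a y = 0 := h.symm
    rwa [h', zero_smul]
  · rw [← le_inv_smul_iff_of_pos h]
    refine hzmin ⟨smul_nonneg (inv_nonneg.2 h.le) hy, ?_⟩
    rw [map_smul, smul_eq_mul, inv_mul_cancel₀ h.ne']

/-- The coordinate vector of one normalized atom is annihilated by the others. -/
theorem IsCoordinate.apply_eq_zero {a b : StrongDual ℝ E} {x : E} (ha : 0 < a)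
    (hb : IsLatticeAtom b) (hx : IsCoordinate a x) (hna : ‖a‖ = 1) (hnb : ‖b‖ = 1) (hab : a ≠ b) :
    b x = 0 := by
  by_contra hne
  have hb0 : 0 ≤ b := hb.1.le
  have hc : 0 < b x := lt_of_le_of_ne (hb0 x hx.1) (Ne.symm hne)
  have hle : b x • a ≤ b := fun z hz => by
    have := dual_apply_mono hb0 (hx.2.2 z hz)
    rw [map_smul, smul_eq_mul, mul_comm] at this
    exact this
  obtain ⟨t, ht⟩ := hb.2 _ (smul_nonneg hc.le ha.le) hle
  have h1 : b x = |t| := by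
    have := congrArg norm ht
    rwa [norm_smul, norm_smul, hna, hnb, mul_one, mul_one, Real.norm_eq_abs, Real.norm_eq_abs,
      abs_of_pos hc] at this
  have ht0 : 0 ≤ t := by
    by_contra! hneg
    have h2 : b x • a ≤ 0 := by
      rw [ht]
      exact smul_nonpos_of_nonpos_of_nonneg hneg.le hb0
    have h3 := h2 x hx.1
    rw [smul_apply, hx.2.1] at h3
    simp only [smul_eq_mul, mul_one, zero_apply] at h3
    exact absurd h3 (not_le.2 hc)
  rw [abs_of_nonneg ht0] at h1
  rw [← h1] at ht
  exact hab (smul_right_injective _ hne ht)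

/-- In an atomic order continuous dual whose atoms have coordinate vectors, order intervals are
uniformly approximated by finitely many coordinates. -/
theorem exists_finset_norm_sub_sum_le (hat : IsAtomicLattice (StrongDual ℝ E))
    (hoc : IsOrderContinuous (StrongDual ℝ E))
    (hco : ∀ a : StrongDual ℝ E, IsLatticeAtom a → ∃ x, IsCoordinate a x)
    {g : StrongDual ℝ E} (hg : 0 ≤ g) {ε : ℝ} (hε : 0 < ε) :
    ∃ (A : Finset (StrongDual ℝ E)) (v : StrongDual ℝ E → E),
      (∀ a ∈ A, IsLatticeAtom a ∧ IsCoordinate a (v a)) ∧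
      ∀ k : StrongDual ℝ E, 0 ≤ k → k ≤ g → ‖k - ∑ a ∈ A, k (v a) • a‖ ≤ ε := by
  classical
  -- Normalization keeps one atom per ray, so distinct indices annihilate each other's coordinate
  -- vectors.
  let I := {a : StrongDual ℝ E // IsLatticeAtom a ∧ ‖a‖ = 1}
  choose! v hv using hco
  let R : Finset I → StrongDual ℝ E → StrongDual ℝ E := fun A k =>
    k - ∑ a ∈ A, k (v a.1) • a.1
  have hRapply : ∀ (A : Finset I) (k : StrongDual ℝ E) (z : E),
      R A k z = k (z - ∑ a ∈ A, a.1 z • v a.1) := fun A k z => by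
    simp only [R, sub_apply, map_sub, map_sum, map_smul, smul_eq_mul,
      FunLike.coe_sum, Finset.sum_apply, smul_apply]
    congr 1
    exact Finset.sum_congr rfl fun a _ => mul_comm _ _
  -- `R A` is the adjoint of this operator on E, so positivity here makes the remainder monotone in
  -- k.
  have hQ : ∀ (A : Finset I) (z : E), 0 ≤ z → 0 ≤ z - ∑ a ∈ A, a.1 z • v a.1 := by
    intro A z hz
    induction A using Finset.induction_on with
    | empty => simpa using hz
    | insert b A hb ih =>
      have h1 : b.1 (z - ∑ a ∈ A, a.1 z • v a.1) = b.1 z := by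
        rw [map_sub, map_sum, Finset.sum_eq_zero, sub_zero]
        intro a haA
        have hne : a.1 ≠ b.1 := fun h => hb (Subtype.ext h ▸ haA)
        rw [map_smul, (hv a.1 a.2.1).apply_eq_zero a.2.1.1 b.2.1 a.2.2 b.2.2 hne, smul_zero]
      have h2 := (hv b.1 b.2.1).2.2 _ ih
      rw [h1] at h2
      rw [Finset.sum_insert hb, sub_add_eq_sub_sub_swap]
      exact sub_nonneg.2 h2
  have hRmono : ∀ (A : Finset I) {k l : StrongDual ℝ E}, k ≤ l → R A k ≤ R A l :=
    fun A k l hkl z hz => by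
      rw [hRapply, hRapply]
      exact hkl _ (hQ A z hz)
  have hRnonneg : ∀ (A : Finset I) {k : StrongDual ℝ E}, 0 ≤ k → 0 ≤ R A k :=
    fun A k hk => by simpa [R] using hRmono A hk
  have hanti : Antitone fun A => R A g := fun A B hAB => by
    refine sub_le_sub_left (Finset.sum_le_sum_of_subset_of_nonneg hAB fun a _ _ => ?_) g
    exact smul_nonneg (hg _ (hv a.1 a.2.1).1) a.2.1.1.le
  have hglb : IsGLB (Set.range fun A => R A g) 0 := by
    refine ⟨?_, fun h hh => ?_⟩
    · rintro _ ⟨A, rfl⟩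
      exact hRnonneg A hg
    · have hle : ∀ A, h⁺ ≤ R A g := fun A => sup_le (hh ⟨A, rfl⟩) (hRnonneg A hg)
      rw [← posPart_eq_zero]
      by_contra hne
      -- Such an atom would lie below every remainder, but the remainder for its own normalization
      -- vanishes at its coordinate vector.
      obtain ⟨b, hb, hbh⟩ := hat h⁺ (lt_of_le_of_ne (posPart_nonneg h) (Ne.symm hne))
      have hnb : 0 < ‖b‖ := norm_pos_iff.2 hb.1.ne'
      let a : I := ⟨‖b‖⁻¹ • b, isLatticeAtom_smul hb (inv_pos.2 hnb), by
        rw [norm_smul, norm_inv, norm_norm, inv_mul_cancel₀ hnb.ne']⟩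
      have hva := hv a.1 a.2.1
      have h1 : b (v a.1) ≤ R {a} g (v a.1) := (hbh.trans (hle {a})) _ hva.1
      rw [hRapply, Finset.sum_singleton, hva.2.1, one_smul, sub_self, map_zero] at h1
      have h2 : ‖b‖⁻¹ * b (v a.1) = 1 := hva.2.1
      have h3 : ‖b‖⁻¹ * b (v a.1) ≤ 0 :=
        mul_nonpos_of_nonneg_of_nonpos (inv_nonneg.2 hnb.le) h1
      linarith
  obtain ⟨A, hA⟩ := ((hoc _ _ hanti hglb).eventually (gt_mem_nhds hε)).exists
  refine ⟨A.map (Function.Embedding.subtype _), v, ?_, fun k hk hkg => ?_⟩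
  · intro a ha
    obtain ⟨b, -, rfl⟩ := Finset.mem_map.1 ha
    exact ⟨b.2.1, hv _ b.2.1⟩
  · rw [Finset.sum_map]
    exact (norm_le_norm_of_nonneg (hRnonneg A hk) (hRmono A hkg)).trans hA.le

theorem tendsto_norm_abs_inf_of_tendsto_apply (hat : IsAtomicLattice (StrongDual ℝ E))
    (hoc : IsOrderContinuous (StrongDual ℝ E))
    (hco : ∀ a : StrongDual ℝ E, IsLatticeAtom a → ∃ x, IsCoordinate a x)
    {ι : Type*} {l : Filter ι} {f : ι → StrongDual ℝ E}
    (hf : ∀ x, Tendsto (fun i => f i x) l (𝓝 0)) {g : StrongDual ℝ E} (hg : 0 ≤ g) :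
    Tendsto (fun i => ‖|f i| ⊓ g‖) l (𝓝 0) := by
  rw [Metric.tendsto_nhds]
  intro ε hε
  obtain ⟨A, v, hA, happrox⟩ := exists_finset_norm_sub_sum_le hat hoc hco hg (half_pos hε)
  have hsum : Tendsto (fun i => ∑ a ∈ A, |f i (v a)| * ‖a‖) l (𝓝 0) := by
    have : Tendsto (fun i => ∑ a ∈ A, |f i (v a)| * ‖a‖) l (𝓝 (∑ a ∈ A, |(0 : ℝ)| * ‖a‖)) :=
      tendsto_finsetSum _ fun a _ => ((hf (v a)).abs).mul_const _
    simpa using this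
  filter_upwards [hsum.eventually (gt_mem_nhds (half_pos hε))] with i hi
  rw [dist_zero_right, norm_norm]
  set k := |f i| ⊓ g with hk
  have hk0 : 0 ≤ k := le_inf (abs_nonneg _) hg
  have h1 : ‖∑ a ∈ A, k (v a) • a‖ ≤ ∑ a ∈ A, |f i (v a)| * ‖a‖ := by
    refine norm_sum_le_of_le _ fun a ha => ?_
    obtain ⟨haa, hav⟩ := hA a ha
    rw [norm_smul, Real.norm_eq_abs, abs_of_nonneg (hk0 _ hav.1),
      ← hav.abs_apply haa.1.le]
    exact mul_le_mul_of_nonneg_right ((inf_le_left : k ≤ |f i|) _ hav.1) (norm_nonneg a)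
  calc ‖k‖ = ‖(k - ∑ a ∈ A, k (v a) • a) + ∑ a ∈ A, k (v a) • a‖ := by rw [sub_add_cancel]
    _ ≤ ε / 2 + ∑ a ∈ A, |f i (v a)| * ‖a‖ :=
      (norm_add_le _ _).trans (add_le_add (happrox k hk0 inf_le_right) h1)
    _ < ε := by linarith

/-- If the dual is atomic and order continuous and its atoms have coordinate vectors, then `E` is
order continuous. -/
theorem isOrderContinuous_of_isCoordinate (hat : IsAtomicLattice (StrongDual ℝ E))
    (hoc : IsOrderContinuous (StrongDual ℝ E))
    (hco : ∀ a : StrongDual ℝ E, IsLatticeAtom a → ∃ x, IsCoordinate a x) :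
    IsOrderContinuous E := by
  intro ι _ _ _ x hx hglb
  have h0 : ∀ i, 0 ≤ x i := fun i => hglb.1 ⟨i, rfl⟩
  have hatom : ∀ a : StrongDual ℝ E, IsLatticeAtom a → Tendsto (fun i => a (x i)) atTop (𝓝 0) := by
    intro a ha
    obtain ⟨y, hy0, hy1, hy⟩ := hco a ha
    have ha0 : 0 ≤ a := ha.1.le
    have hanti : Antitone fun i => a (x i) := fun i j hij => dual_apply_mono ha0 (hx hij)
    have hbdd : BddBelow (Set.range fun i => a (x i)) := ⟨0, by
      rintro _ ⟨i, rfl⟩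
      exact ha0 _ (h0 i)⟩
    have ht := tendsto_atTop_ciInf hanti hbdd
    set c := ⨅ i, a (x i) with hc
    -- The coordinate inequality gives c • y ≤ a (x i) • y ≤ x i for every i.
    have hcy : c • y ≤ 0 := by
      refine hglb.2 ?_
      rintro _ ⟨i, rfl⟩
      exact (smul_le_smul_of_nonneg_right (ciInf_le hbdd i) hy0).trans (hy _ (h0 i))
    have hc0 : c ≤ 0 := by
      have := dual_apply_mono ha0 hcy
      rwa [map_smul, hy1, map_zero, smul_eq_mul, mul_one] at this
    rwa [le_antisymm hc0 (le_ciInf fun i => ha0 _ (h0 i))] at ht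
  have hpos : ∀ g : StrongDual ℝ E, 0 ≤ g → Tendsto (fun i => g (x i)) atTop (𝓝 0) := by
    intro g hg
    rw [Metric.tendsto_nhds]
    intro ε hε
    obtain ⟨i₀⟩ := ‹Nonempty ι›
    set M := ‖x i₀‖ + 1 with hM
    have hMpos : 0 < M := by positivity
    obtain ⟨A, v, hA, happrox⟩ :=
      exists_finset_norm_sub_sum_le hat hoc hco hg (div_pos (half_pos hε) hMpos)
    have hsum : Tendsto (fun i => ∑ a ∈ A, g (v a) * a (x i)) atTop (𝓝 0) := by
      have : Tendsto (fun i => ∑ a ∈ A, g (v a) * a (x i)) atTop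
          (𝓝 (∑ a ∈ A, g (v a) * 0)) :=
        tendsto_finsetSum _ fun a ha => (hatom a (hA a ha).1).const_mul _
      simpa using this
    filter_upwards [hsum.eventually (gt_mem_nhds (half_pos hε)), eventually_ge_atTop i₀]
      with i hi hii
    rw [dist_zero_right, Real.norm_eq_abs, abs_of_nonneg (hg _ (h0 i))]
    have h1 : g (x i) = (g - ∑ a ∈ A, g (v a) • a) (x i) + ∑ a ∈ A, g (v a) * a (x i) := by
      simp only [sub_apply, FunLike.coe_sum, Finset.sum_apply, smul_apply, smul_eq_mul]
      ring
    have h2 : (g - ∑ a ∈ A, g (v a) • a) (x i) ≤ ε / 2 / M * M := by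
      refine (Real.le_norm_self _).trans ((ContinuousLinearMap.le_opNorm _ _).trans ?_)
      refine mul_le_mul (happrox g hg le_rfl) ?_ (norm_nonneg _) (by positivity)
      have := norm_le_norm_of_nonneg (h0 i) (hx hii)
      linarith
    rw [div_mul_cancel₀ _ hMpos.ne'] at h2
    linarith
  refine tendsto_norm_of_weakly_null hx h0 fun f => ?_
  have := (hpos f⁺ (posPart_nonneg f)).sub (hpos f⁻ (negPart_nonneg f))
  rw [sub_zero] at this
  refine this.congr fun i => ?_
  rw [← sub_apply, posPart_sub_negPart]

end Coordinates

end BanachLattice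

/-! ### Nets and weak topologies. -/

namespace BanachLattice

theorem tendsto_nhds_of_forall_net {X : Type u} {Y : Type*} [TopologicalSpace X] {x : X} {φ : X → Y}
    {l : Filter Y}
    (h : ∀ (ι : Type u) [Preorder ι] [IsDirectedOrder ι] [Nonempty ι] (f : ι → X),
      Tendsto f atTop (𝓝 x) → Tendsto (fun i => φ (f i)) atTop l) : Tendsto φ (𝓝 x) l := by
  -- Pointed neighbourhoods under reverse inclusion form a universal net to x without leaving the
  -- universe of X.
  let ι : Type u := {p : X × Set X // p.2 ∈ 𝓝 x ∧ p.1 ∈ p.2}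
  let _ : Preorder ι := Preorder.lift fun p => OrderDual.toDual p.1.2
  have hle : ∀ p q : ι, p ≤ q ↔ q.1.2 ⊆ p.1.2 := fun _ _ => Iff.rfl
  have : Nonempty ι := ⟨⟨(x, Set.univ), univ_mem, trivial⟩⟩
  have : IsDirectedOrder ι := ⟨fun p q =>
    ⟨⟨(x, p.1.2 ∩ q.1.2), inter_mem p.2.1 q.2.1, mem_of_mem_nhds p.2.1, mem_of_mem_nhds q.2.1⟩,
      Set.inter_subset_left, Set.inter_subset_right⟩⟩
  have hlim : Tendsto (fun p : ι => p.1.1) atTop (𝓝 x) := by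
    intro U hU
    refine mem_map.2 <| mem_of_superset
      (eventually_ge_atTop (⟨(x, U), hU, mem_of_mem_nhds hU⟩ : ι)) fun p hp => hp p.2.2
  intro V hV
  obtain ⟨p, hp⟩ := mem_atTop_sets.1 (h ι _ hlim hV)
  refine mem_map.2 (mem_of_superset p.2.1 fun y hy => ?_)
  exact hp ⟨(y, p.1.2), p.2.1, hy⟩ ((hle _ _).2 subset_rfl)

theorem tendsto_apply_of_tendsto_toWeakSpace {F : Type*} [NormedAddCommGroup F] [NormedSpace ℝ F]
    {ι : Type*} {l : Filter ι} {x : ι → F}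
    (h : Tendsto (fun i => toWeakSpace ℝ F (x i)) l (𝓝 0)) (φ : StrongDual ℝ F) :
    Tendsto (fun i => φ (x i)) l (𝓝 0) := by
  have hc : Tendsto (fun y : WeakSpace ℝ F => φ ((toWeakSpace ℝ F).symm y)) (𝓝 0) (𝓝 (φ 0)) :=
    (WeakBilin.eval_continuous (topDualPairing ℝ F).flip φ).tendsto 0
  rw [map_zero] at hc
  exact hc.comp h

theorem tendsto_toWeakSpace_of_norm {F : Type*} [NormedAddCommGroup F] [NormedSpace ℝ F]
    {ι : Type*} {l : Filter ι} {x : ι → F} (h : Tendsto (fun i => ‖x i‖) l (𝓝 0)) :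
    Tendsto (fun i => toWeakSpace ℝ F (x i)) l (𝓝 0) := by
  have hc := (toWeakSpaceCLM ℝ F).continuous.tendsto 0
  rw [map_zero] at hc
  exact hc.comp (tendsto_zero_iff_norm_tendsto_zero.2 h)

theorem exists_finset_of_mem_nhds_weakDual {E : Type*} [NormedAddCommGroup E] [NormedSpace ℝ E]
    {U : Set (WeakDual ℝ E)} (hU : U ∈ 𝓝 0) :
    ∃ s : Finset E, ∀ f : WeakDual ℝ E, (∀ y ∈ s, f y = 0) → f ∈ U := by
  have hind : 𝓝 (0 : WeakDual ℝ E) = comap (fun (f : WeakDual ℝ E) (y : E) => f y) (𝓝 fun _ => 0) :=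
    nhds_induced _ _
  rw [hind, mem_comap] at hU
  obtain ⟨V, hV, hVU⟩ := hU
  rw [nhds_pi, Filter.mem_pi] at hV
  obtain ⟨I, hI, t, ht, htV⟩ := hV
  refine ⟨hI.toFinset, fun f hf => hVU (htV fun y hy => ?_)⟩
  change f y ∈ t y
  rw [hf y (hI.mem_toFinset.2 hy)]
  exact mem_of_mem_nhds (ht y)

/-! ### Consequences of w*-null nets being uaw-null. -/

section Necessity

variable {E : Type u} [NormedAddCommGroup E] [NormedSpace ℝ E] [Lattice E]
  [IsOrderedAddMonoid E] [IsOrderedModule ℝ E] [HasSolidNorm E]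

theorem isOrderContinuous_dual_of_weakStar_uaw
    (H : ∀ (ι : Type u) [Preorder ι] [IsDirectedOrder ι] [Nonempty ι] (f : ι → StrongDual ℝ E),
      Tendsto (fun i => StrongDual.toWeakDual (f i)) atTop (𝓝 0) → UawTendsto f 0) :
    IsOrderContinuous (StrongDual ℝ E) := by
  intro ι _ _ _ f hf hglb
  have h0 : ∀ i, 0 ≤ f i := fun i => hglb.1 ⟨i, rfl⟩
  refine tendsto_norm_of_weakly_null hf h0 fun φ => ?_
  have hw : Tendsto (fun i => StrongDual.toWeakDual (f i)) atTop (𝓝 0) := by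
    rw [tendsto_iff_forall_eval_tendsto_topDualPairing]
    exact tendsto_apply_of_antitone_dual hf hglb
  obtain ⟨i₀⟩ := ‹Nonempty ι›
  refine (tendsto_apply_of_tendsto_toWeakSpace (H ι f hw (f i₀) (h0 i₀)) φ).congr' ?_
  filter_upwards [eventually_ge_atTop i₀] with i hi
  rw [sub_zero, abs_of_nonneg (h0 i), inf_of_le_left (hf hi)]

theorem tendsto_abs_inf_apply_of_weakStar_uaw
    (H : ∀ (ι : Type u) [Preorder ι] [IsDirectedOrder ι] [Nonempty ι] (f : ι → StrongDual ℝ E),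
      Tendsto (fun i => StrongDual.toWeakDual (f i)) atTop (𝓝 0) → UawTendsto f 0)
    {g : StrongDual ℝ E} (hg : 0 ≤ g) (x : E) :
    Tendsto (fun f : WeakDual ℝ E => (|f.toStrongDual| ⊓ g) x) (𝓝 0) (𝓝 0) := by
  refine tendsto_nhds_of_forall_net fun ι _ _ _ f hf => ?_
  have h := tendsto_apply_of_tendsto_toWeakSpace
    (H ι (fun i => (f i).toStrongDual) hf g hg) (NormedSpace.inclusionInDoubleDual ℝ E x)
  refine h.congr fun i => ?_
  rw [sub_zero]
  rfl

/-- If m is disjoint from a then |a - m| ∧ a = a, so a - m cannot be w*-small. A w*-continuous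
functional is evaluation at some y in E, so separation yields y annihilating the disjoint complement
with a(y) > 0; positive functionals split along a and certify the rescaled y. -/
theorem exists_isCoordinate_of_tendsto {a : StrongDual ℝ E} (ha : IsLatticeAtom a)
    (H : ∀ x, Tendsto (fun f : WeakDual ℝ E => (|f.toStrongDual| ⊓ a) x) (𝓝 0) (𝓝 0)) :
    ∃ x, IsCoordinate a x := by
  obtain ⟨u, hu0, hu1⟩ := exists_apply_eq_one ha.1
  set M : Submodule ℝ (WeakDual ℝ E) :=
    (disjointCompl a ha.1.le).map (StrongDual.toWeakDual (𝕜 := ℝ) (E := E)).toLinearMap with hM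
  have hcl : StrongDual.toWeakDual a ∉ closure (M : Set (WeakDual ℝ E)) := by
    intro hmem
    have hcont : Tendsto (fun h : WeakDual ℝ E => StrongDual.toWeakDual a - h)
        (𝓝 (StrongDual.toWeakDual a)) (𝓝 0) := by
      rw [← sub_self (StrongDual.toWeakDual a)]
      exact tendsto_const_nhds.sub tendsto_id
    have hev := hcont.eventually ((H u).eventually (gt_mem_nhds zero_lt_one))
    obtain ⟨m, hm1, hm2⟩ := mem_closure_iff_frequently.1 hmem |>.and_eventually hev |>.exists
    obtain ⟨m, hm, rfl⟩ := hm1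
    have hle : a ≤ |a - m| := le_abs_sub_of_disjoint hm
    have hm3 : (|a - m| ⊓ a) u < 1 := hm2
    rw [inf_of_le_right hle, hu1] at hm3
    exact lt_irrefl _ hm3
  have : LocallyConvexSpace ℝ (WeakDual ℝ E) :=
    inferInstanceAs (LocallyConvexSpace ℝ (WeakBilin (topDualPairing ℝ E)))
  obtain ⟨L, r, hL, hr⟩ :=
    geometric_hahn_banach_closed_point M.convex.closure isClosed_closure hcl
  obtain ⟨y, hy⟩ := LinearMap.dualEmbedding_surjective (topDualPairing ℝ E) L
  have hLy : ∀ f : StrongDual ℝ E, L (StrongDual.toWeakDual f) = f y := fun f => by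
    rw [← hy]
    rfl
  have hr0 : 0 < r := by
    have := hL 0 (subset_closure M.zero_mem)
    rwa [map_zero] at this
  have hMy : ∀ m ∈ disjointCompl a ha.1.le, m y = 0 := by
    intro m hm
    by_contra hne
    have hmem : StrongDual.toWeakDual ((r / m y) • m) ∈ M :=
      Submodule.mem_map_of_mem (Submodule.smul_mem _ _ hm)
    have := hL _ (subset_closure hmem)
    rw [hLy, smul_apply, smul_eq_mul, div_mul_cancel₀ _ hne] at this
    exact lt_irrefl _ this
  have hay : 0 < a y := by
    rw [hLy] at hr
    exact hr0.trans hr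
  have key : ∀ f : StrongDual ℝ E, 0 ≤ f →
      ∃ t : ℝ, 0 ≤ t ∧ f y = t * a y ∧ ∀ x, 0 ≤ x → t * a x ≤ f x := by
    intro f hf
    obtain ⟨t, ht0, ht, hd⟩ := ha.exists_decomposition hf
    refine ⟨t, ht0, ?_, fun x hx => ht x hx⟩
    have := hMy _ hd
    rw [sub_apply, smul_apply, smul_eq_mul] at this
    linarith
  refine ⟨(a y)⁻¹ • y, ?_, ?_, fun x hx => ?_⟩
  · refine nonneg_of_forall_dual fun f hf => ?_
    obtain ⟨t, ht0, hty, -⟩ := key f hf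
    rw [map_smul, smul_eq_mul, hty]
    positivity
  · rw [map_smul, smul_eq_mul, inv_mul_cancel₀ hay.ne']
  · rw [← sub_nonneg]
    refine nonneg_of_forall_dual fun f hf => ?_
    obtain ⟨t, -, hty, htx⟩ := key f hf
    rw [map_sub, map_smul, map_smul, hty, smul_eq_mul, smul_eq_mul, mul_comm t,
      inv_mul_cancel_left₀ hay.ne', mul_comm, sub_nonneg]
    exact htx x hx

theorem isAtomicLattice_dual_of_tendsto
    (H : ∀ g : StrongDual ℝ E, 0 ≤ g → ∀ x,
      Tendsto (fun f : WeakDual ℝ E => (|f.toStrongDual| ⊓ g) x) (𝓝 0) (𝓝 0)) :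
    IsAtomicLattice (StrongDual ℝ E) := by
  classical
  intro g hg
  by_contra hna
  push Not at hna
  obtain ⟨u, hu0, hu1⟩ := exists_apply_eq_one hg
  obtain ⟨s, hs⟩ := exists_finset_of_mem_nhds_weakDual
    ((H g hg.le u).eventually (gt_mem_nhds zero_lt_one))
  -- w*-compact by Alaoglu, so it has an extreme point D. If |D| ≠ g, the atomless gap g - |D|
  -- contains a perturbation k vanishing on s, and D is the midpoint of D ± k in K.
  let K : Set (WeakDual ℝ E) :=
    {f | -g ≤ f.toStrongDual ∧ f.toStrongDual ≤ g} ∩ ⋂ y ∈ s, {f | f y = 0}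
  have hKmem : ∀ f : StrongDual ℝ E, StrongDual.toWeakDual f ∈ K ↔ |f| ≤ g ∧ ∀ y ∈ s, f y = 0 := by
    intro f
    rw [abs_le', neg_le, and_comm (a := f ≤ g)]
    simp only [K, Set.mem_inter_iff, Set.mem_iInter, Set.mem_ofPred_eq]
    rfl
  have hcomp : IsCompact K := by
    refine (WeakDual.isCompact_closedBall (0 : StrongDual ℝ E) ‖g‖).of_isClosed_subset ?_ ?_
    · refine (isClosed_toWeakDual_preimage_Icc (-g) g).inter ?_
      exact isClosed_biInter fun y _ => isClosed_eq (WeakDual.eval_continuous y) continuous_const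
    · intro f hf
      have hf' := ((hKmem f.toStrongDual).1 hf).1
      rw [Set.mem_preimage, mem_closedBall_zero_iff]
      apply HasSolidNorm.solid
      rwa [abs_of_nonneg hg.le]
  have : LocallyConvexSpace ℝ (WeakDual ℝ E) :=
    inferInstanceAs (LocallyConvexSpace ℝ (WeakBilin (topDualPairing ℝ E)))
  obtain ⟨d, hd⟩ := hcomp.extremePoints_nonempty
    ⟨StrongDual.toWeakDual 0, (hKmem 0).2 ⟨by simpa using hg.le, by simp⟩⟩
  set D : StrongDual ℝ E := d.toStrongDual with hD
  obtain ⟨hDg, hDs⟩ := (hKmem D).1 hd.1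
  have habs : |D| = g := by
    by_contra hne
    have hpos : 0 < g - |D| :=
      lt_of_le_of_ne (sub_nonneg.2 hDg) fun h => hne (sub_eq_zero.1 h.symm).symm
    obtain ⟨k, hk0, hkle, hks⟩ := exists_ne_zero_abs_le_forall_eq_zero
      (fun y : E => (NormedSpace.inclusionInDoubleDual ℝ E y).toLinearMap) s (g - |D|) hpos
      fun b hb hbg => hna b hb (hbg.trans (sub_le_self _ (abs_nonneg _)))
    have hks' : ∀ y ∈ s, k y = 0 := hks
    have hmem : ∀ k' : StrongDual ℝ E, |k'| = |k| → (∀ y ∈ s, k' y = 0) →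
        StrongDual.toWeakDual (D + k') ∈ K := by
      intro k' hk' hs'
      refine (hKmem _).2 ⟨(abs_add_le _ _).trans ?_, fun y hy => ?_⟩
      · rw [hk']
        exact le_sub_iff_add_le'.1 hkle
      · rw [add_apply, hDs y hy, hs' y hy, add_zero]
    have h1 := hmem k rfl hks'
    have h2 := hmem (-k) (abs_neg k) fun y hy => by rw [neg_apply, hks' y hy, neg_zero]
    have h3 : d ∈ openSegment ℝ (StrongDual.toWeakDual (D + k))
        (StrongDual.toWeakDual (D + -k)) := by
      refine ⟨1 / 2, 1 / 2, by norm_num, by norm_num, by norm_num, ?_⟩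
      rw [← map_smul, ← map_smul, ← map_add, ← smul_add]
      have : (1 / 2 : ℝ) • (D + k + (D + -k)) = D := by module
      rw [this]
      rfl
    have h4 : StrongDual.toWeakDual (D + k) = d := hd.2 h1 h2 h3
    have h5 : D + k = D := h4
    exact hk0 (by simpa using h5)
  have hlt : (|D| ⊓ g) u < 1 := hs d hDs
  rw [habs, inf_idem, hu1] at hlt
  exact lt_irrefl _ hlt

end Necessity

end BanachLattice

/-! ### The equivalence. -/

theorem mainTheorem6 (E : Type u) [NormedAddCommGroup E] [NormedSpace ℝ E] [CompleteSpace E]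
    [Lattice E] [IsOrderedAddMonoid E] [IsOrderedModule ℝ E] [HasSolidNorm E] :
    (∀ (ι : Type u) [Preorder ι] [IsDirectedOrder ι] [Nonempty ι] (f : ι → StrongDual ℝ E),
        Tendsto (fun i => StrongDual.toWeakDual (f i)) atTop (𝓝 0) →
          BanachLattice.UawTendsto f 0) ↔
      BanachLattice.IsAtomicLattice (StrongDual ℝ E) ∧
        BanachLattice.IsOrderContinuous E ∧
        BanachLattice.IsOrderContinuous (StrongDual ℝ E) := by
  constructor
  · intro H
    have hlim := fun (g : StrongDual ℝ E) (hg : 0 ≤ g) (x : E) =>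
      BanachLattice.tendsto_abs_inf_apply_of_weakStar_uaw H hg x
    have hat := BanachLattice.isAtomicLattice_dual_of_tendsto hlim
    have hoc := BanachLattice.isOrderContinuous_dual_of_weakStar_uaw H
    exact ⟨hat, BanachLattice.isOrderContinuous_of_isCoordinate hat hoc fun a ha =>
      BanachLattice.exists_isCoordinate_of_tendsto ha (hlim a ha.1.le), hoc⟩
  · rintro ⟨hat, hE, hoc⟩ ι _ _ _ f hf g hg
    have hf' : ∀ x, Tendsto (fun i => f i x) atTop (𝓝 0) :=
      (tendsto_iff_forall_eval_tendsto_topDualPairing (𝕜 := ℝ)).1 hf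
    refine BanachLattice.tendsto_toWeakSpace_of_norm ?_
    simp only [sub_zero]
    exact BanachLattice.tendsto_norm_abs_inf_of_tendsto_apply hat hoc
      (fun a ha => hE.exists_isCoordinate ha) hf' hg
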